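/- Let $E$ be a reflexive Fréchet space over $\mathbb{K}\in\{\mathbb{R},\mathbb{C}\}$, i.e. a complete metrizable locally convex space such that the canonical map of $E$ into its bidual $(E'_\beta)'_\beta$ (where $\beta$ denotes the strong topology, of uniform convergence on bounded sets) is a topological isomorphism onto. A family $\mathcal N$ of subsets of a topological space $X$ is a $k$-network if for all $K\subseteq U\subseteq X$ with $K$ compact and $U$ open there is a finite $\mathcal F\subseteq\mathcal N$ with $K\subseteq\bigcup\mathcal F\subseteq U$. A space $X$ is an $\aleph_0$-space if it is regular (Hausdorff) and has a countable $k$-network, and an $\aleph$-space if it is regular (Hausdorff) and has a $\sigma$-locally finite $k$-network, i.e. one that is a countable union of locally finite families. Then the following are equivalent: 1. $E$ with the weak topology $\sigma(E,E')$ is an $\aleph$-space; 2. $E$ (with its original topology) is separable; 3. $E$ with the weak topology $\sigma(E,E')$ is an $\aleph_0$-space. -/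

import Mathlib

/-- A family `N` of subsets of `X` is a `k`-network if whenever `K ⊆ U` with `K` compact and `U`
open, there is a finite subfamily `F ⊆ N` with `K ⊆ ⋃ F ⊆ U`. -/
def IsKNetwork {X : Type*} [TopologicalSpace X] (N : Set (Set X)) : Prop :=
  ∀ K U : Set X, IsCompact K → IsOpen U → K ⊆ U →
    ∃ F : Set (Set X), F ⊆ N ∧ F.Finite ∧ K ⊆ ⋃₀ F ∧ ⋃₀ F ⊆ U

/-- A family `N` of subsets of `X` is `σ`-locally finite if it is a countable union of locally
finite families. -/
def IsSigmaLocallyFinite {X : Type*} [TopologicalSpace X] (N : Set (Set X)) : Prop :=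
  ∃ D : ℕ → Set (Set X),
    (∀ n, LocallyFinite (fun s : D n => (s : Set X))) ∧ N = ⋃ n, D n

/-- An `ℵ₀`-space: a regular (Hausdorff) space with a countable `k`-network. -/
def IsAlephZeroSpace (X : Type*) [TopologicalSpace X] : Prop :=
  T3Space X ∧ ∃ N : Set (Set X), N.Countable ∧ IsKNetwork N

/-- An `ℵ`-space: a regular (Hausdorff) space with a `σ`-locally finite `k`-network. -/
def IsAlephSpace (X : Type*) [TopologicalSpace X] : Prop :=
  T3Space X ∧ ∃ N : Set (Set X), IsSigmaLocallyFinite N ∧ IsKNetwork N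

section

variable (𝕜 E : Type*) [RCLike 𝕜] [AddCommGroup E] [Module 𝕜 E] [TopologicalSpace E]

/-- `E` is weakly an `ℵ₀`-space: `E` with the weak topology `σ(E, E')` is an `ℵ₀`-space. -/
def IsWeaklyAlephZeroSpace : Prop :=
  IsAlephZeroSpace (WeakSpace 𝕜 E)

/-- `E` is weakly an `ℵ`-space: `E` with the weak topology `σ(E, E')` is an `ℵ`-space. -/
def IsWeaklyAlephSpace : Prop :=
  IsAlephSpace (WeakSpace 𝕜 E)

/-- The canonical evaluation map `x ↦ (f ↦ f x)` from `E` to its strong bidual. Here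
`StrongDual 𝕜 E` is the continuous dual with the topology of uniform convergence on the
(von Neumann) bounded subsets of `E`. -/
def canonicalBidualMap [ContinuousSMul 𝕜 E] (x : E) : StrongDual 𝕜 (StrongDual 𝕜 E) where
  toFun f := f x
  map_add' _ _ := rfl
  map_smul' _ _ := rfl
  cont := ContinuousEvalConst.continuous_eval_const x

/-- `E` is reflexive: the canonical (linear) map from `E` to its strong bidual is a bijective
homeomorphism. -/
def IsReflexiveLCS [ContinuousSMul 𝕜 E] : Prop :=
  IsHomeomorph (canonicalBidualMap 𝕜 E)

end

/-!
Why the three conditions are equivalent, for a reflexive metrizable locally convex space `E` with a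
fundamental sequence of seminorms `p`. To `α : ℕ → ℕ` belong the decreasing boxes
`B k = {x | ∀ i < k, p i x ≤ α i + 1}`. There are only countably many boxes altogether, since `B k`
depends on the first `k` values of `α` only, and a sequence with `x k ∈ B k` for all `k` is bounded
(`IsFundamentalSeq.isVonNBounded_range`). The argument rests on this observation.

*Weakly `ℵ` implies weakly `ℵ₀`.* Every locally finite family of sets in the weak topology is
countable (`IsReflexiveLCS.countable_of_locallyFinite`). Otherwise some `α` would have all its boxes
meeting infinitely many members of the family; points `x k ∈ B k` in distinct members form a bounded
sequence, which by reflexivity has a weak cluster point, and the family is not locally finite there.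

*Weakly `ℵ₀` implies separable.* A countable `k`-network gives a countable weakly dense set, whose
linear span is dense in the original topology by the Hahn-Banach theorem.

*Separable implies weakly `ℵ₀`.* The strong dual has a countable network
(`IsReflexiveLCS.exists_countable_network_strongDual`). It is separable, because a countable set of
functionals that separates points of `E` has dense span by reflexivity. Moreover the union over `k`
of the tubes `{f | |f| ≤ 2 on B k}` is a neighbourhood of zero: reflexivity and the Hahn-Banach
theorem put the polar of `⋂ k, B k` inside the closure of the union of the tubes of radius `1`, and
boundedness of the sequences above puts this closure inside the union of the tubes of radius `2`.
Hence translates of tubes by points of a countable dense set form a network. Finally, if `P` runs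
through a countable network of the strong dual and `O` through countably many open sets of scalars,
the sets `{x | ∀ g ∈ P, g x ∈ O}` separate weakly compact sets from subbasic weakly open sets
(`exists_countable_isKNetwork_weakSpace`): a weakly compact set `K` is bounded by Mackey's theorem,
so that `{g | g '' K ⊆ O}` is a strong neighbourhood of each functional mapping `K` into `O`.
-/

open Filter Topology Set Bornology


/-! ### Countable `k`-networks -/

section Topology

variable {X : Type*} [TopologicalSpace X]

theorem IsKNetwork.exists_mem_subset {N : Set (Set X)} (hN : IsKNetwork N) {x : X} {U : Set X}
    (hU : IsOpen U) (hx : x ∈ U) : ∃ A ∈ N, x ∈ A ∧ A ⊆ U := by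
  obtain ⟨F, hFN, -, hxF, hFU⟩ := hN {x} U isCompact_singleton hU (singleton_subset_iff.2 hx)
  obtain ⟨A, hA, hxA⟩ := hxF rfl
  exact ⟨A, hFN hA, hxA, (subset_sUnion_of_mem hA).trans hFU⟩

theorem IsKNetwork.separableSpace {N : Set (Set X)} (hN : IsKNetwork N) (hc : N.Countable) :
    TopologicalSpace.SeparableSpace X := by
  have : Countable {A // A ∈ N ∧ A.Nonempty} :=
    (hc.mono fun A hA => hA.1 : {A | A ∈ N ∧ A.Nonempty}.Countable)
  refine ⟨range fun A : {A // A ∈ N ∧ A.Nonempty} => A.2.2.some, countable_range _, ?_⟩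
  refine dense_iff_inter_open.2 fun U hU ⟨x, hx⟩ => ?_
  obtain ⟨A, hA, hxA, hAU⟩ := hN.exists_mem_subset hU hx
  exact ⟨_, hAU (Set.Nonempty.some_mem ⟨x, hxA⟩), ⟨A, hA, x, hxA⟩, rfl⟩

theorem IsAlephZeroSpace.isAlephSpace (h : IsAlephZeroSpace X) : IsAlephSpace X := by
  obtain ⟨hX, N, hc, hN⟩ := h
  have := hc.to_subtype
  refine ⟨hX, N, ?_, hN⟩
  rcases N.eq_empty_or_nonempty with rfl | hne
  · exact ⟨fun _ => ∅, fun n => locallyFinite_of_finite _, by simp⟩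
  · obtain ⟨e, rfl⟩ := hc.exists_eq_range hne
    exact ⟨fun n => {e n}, fun n => locallyFinite_of_finite _, by ext; simp [eq_comm]⟩

/-- A countable family `M` that separates compact sets from the members of a subbase yields a
countable `k`-network, consisting of the finite intersections of members of `M`. -/
theorem exists_countable_isKNetwork_of_subbase [RegularSpace X] {S : Set (Set X)}
    (hS : ‹TopologicalSpace X› = TopologicalSpace.generateFrom S) {M : Set (Set X)}
    (hM : M.Countable)
    (h : ∀ s ∈ S, ∀ K, IsCompact K → K ⊆ s → ∃ A ∈ M, K ⊆ A ∧ A ⊆ s) :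
    ∃ N : Set (Set X), N.Countable ∧ IsKNetwork N := by
  refine ⟨sInter '' {F | F.Finite ∧ F ⊆ M}, (countable_ofPred_finite_subset hM).image _, ?_⟩
  intro K U hK hU hKU
  suffices H : ∀ x ∈ K, ∃ t ∈ 𝓝[K] x, ∃ F ⊆ sInter '' {F | F.Finite ∧ F ⊆ M}, F.Finite ∧
      t ⊆ ⋃₀ F ∧ ⋃₀ F ⊆ U by
    refine hK.induction_on (p := fun t => ∃ F ⊆ sInter '' {F | F.Finite ∧ F ⊆ M}, F.Finite ∧
      t ⊆ ⋃₀ F ∧ ⋃₀ F ⊆ U) ⟨∅, by simp⟩ ?_ ?_ H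
    · rintro s t hst ⟨F, h1, h2, h3, h4⟩
      exact ⟨F, h1, h2, hst.trans h3, h4⟩
    · rintro s t ⟨F, h1, h2, h3, h4⟩ ⟨G, k1, k2, k3, k4⟩
      refine ⟨F ∪ G, union_subset h1 k1, h2.union k2, ?_, ?_⟩ <;> rw [sUnion_union]
      · exact union_subset_union h3 k3
      · exact union_subset h4 k4
  intro x hx
  obtain ⟨B, ⟨F, ⟨hFf, hFS⟩, rfl⟩, hxB, hBU⟩ :=
    (TopologicalSpace.isTopologicalBasis_of_subbasis hS).exists_subset_of_mem_open (hKU hx) hU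
  have hBo : IsOpen (⋂₀ F) := hFf.isOpen_sInter fun s hs => by
    rw [hS]; exact TopologicalSpace.isOpen_generateFrom_of_mem (hFS hs)
  -- By regularity a compact part `K ∩ C` of `K`, a neighbourhood of `x` in `K`, lies in all members
  -- of `F`.
  obtain ⟨C, hCx, hCc, hCB⟩ := exists_mem_nhds_isClosed_subset (hBo.mem_nhds hxB)
  choose! A hAM hKA hAs using fun s (hs : s ∈ F) => h s (hFS hs) (K ∩ C) (hK.inter_right hCc)
    (inter_subset_right.trans (hCB.trans (sInter_subset_of_mem hs)))
  refine ⟨K ∩ C, inter_mem_nhdsWithin K hCx, {⋂₀ (A '' F)}, ?_, finite_singleton _, ?_, ?_⟩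
  · rintro _ rfl
    exact ⟨_, ⟨hFf.image A, image_subset_iff.2 hAM⟩, rfl⟩
  · rw [sUnion_singleton, sInter_image]
    exact subset_iInter₂ hKA
  · rw [sUnion_singleton, sInter_image]
    exact (subset_sInter fun s hs => (biInter_subset_of_mem hs).trans (hAs s hs)).trans hBU

/-- In a second countable space, countably many open sets suffice to interpolate between compact
sets and their open neighbourhoods. -/
theorem exists_countable_isOpen_interpolation (Y : Type*) [TopologicalSpace Y]
    [SecondCountableTopology Y] :
    ∃ B : Set (Set Y), B.Countable ∧ (∀ O ∈ B, IsOpen O) ∧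
      ∀ K V, IsCompact K → IsOpen V → K ⊆ V → ∃ O ∈ B, K ⊆ O ∧ O ⊆ V := by
  let b := TopologicalSpace.countableBasis Y
  have hb : TopologicalSpace.IsTopologicalBasis b := TopologicalSpace.isBasis_countableBasis Y
  refine ⟨sUnion '' {F | F.Finite ∧ F ⊆ b}, (countable_ofPred_finite_subset
    (TopologicalSpace.countable_countableBasis Y)).image _, ?_, ?_⟩
  · rintro _ ⟨F, ⟨-, hF⟩, rfl⟩
    exact isOpen_sUnion fun s hs => hb.isOpen (hF hs)
  · intro K V hK hV hKV
    have := hK.elim_finite_subcover_image (b := {s ∈ b | s ⊆ V}) (c := id)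
      (fun s hs => hb.isOpen hs.1) fun x hx => by
        obtain ⟨s, hs, hxs, hsV⟩ := hb.exists_subset_of_mem_open (hKV hx) hV
        exact mem_biUnion (show s ∈ {s ∈ b | s ⊆ V} from ⟨hs, hsV⟩) hxs
    obtain ⟨F, hF, hFf, hKF⟩ := this
    refine ⟨⋃₀ F, ⟨F, ⟨hFf, fun s hs => (hF hs).1⟩, rfl⟩, by simpa [sUnion_eq_biUnion] using hKF,
      sUnion_subset fun s hs => (hF hs).2⟩

end Topology

/-! ### Fundamental sequences of seminorms and bounded sets -/

section Seminorms

variable {𝕜 E : Type*} [RCLike 𝕜] [AddCommGroup E] [Module 𝕜 E]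

/-- The uniform boundedness principle for one seminorm: it is applied on the dual of `E` seminormed
by `p`, which is complete even when `E` is not. -/
theorem Seminorm.exists_bound_of_forall_dual (p : Seminorm 𝕜 E) {S : Set E}
    (h : ∀ f : E →ₗ[𝕜] 𝕜, (∃ C, ∀ x, ‖f x‖ ≤ C * p x) → ∃ M, ∀ x ∈ S, ‖f x‖ ≤ M) :
    ∃ M, ∀ x ∈ S, p x ≤ M := by
  let : SeminormedAddCommGroup E := p.toAddGroupSeminorm.toSeminormedAddCommGroup
  let : NormedSpace 𝕜 E := ⟨fun c x => (map_smul_eq_mul p c x).le⟩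
  obtain ⟨M, hM⟩ := banach_steinhaus (g := fun x : S => NormedSpace.inclusionInDoubleDual 𝕜 E x)
    fun f => by
      obtain ⟨M, hM⟩ := h f.toLinearMap ⟨‖f‖, fun x => f.le_opNorm x⟩
      exact ⟨M, fun x => hM x x.2⟩
  refine ⟨max M 0, fun x hx => NormedSpace.norm_le_dual_bound 𝕜 x (le_max_right _ _) fun f => ?_⟩
  exact ((NormedSpace.inclusionInDoubleDual 𝕜 E x).le_opNorm f).trans
    (mul_le_mul_of_nonneg_right ((hM ⟨x, hx⟩).trans (le_max_left _ _)) (norm_nonneg f))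

/-- The set on which the first `k` seminorms of the sequence `p` are bounded by `a i + 1`.
The summand `1` keeps every bound positive, so that one may divide by it. -/
def seminormBox (p : ℕ → Seminorm 𝕜 E) {k : ℕ} (a : Fin k → ℕ) : Set E :=
  {x | ∀ i : Fin k, p i x ≤ a i + 1}

theorem mem_seminormBox_restrict {p : ℕ → Seminorm 𝕜 E} {α : ℕ → ℕ} {k : ℕ} {x : E} :
    x ∈ seminormBox p (fun i : Fin k => α i) ↔ ∀ i < k, p i x ≤ α i + 1 :=
  ⟨fun h i hi => h ⟨i, hi⟩, fun h i => h i i.2⟩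

theorem seminormBox_restrict_antitone (p : ℕ → Seminorm 𝕜 E) (α : ℕ → ℕ) :
    Antitone fun k => seminormBox p (fun i : Fin k => α i) := fun _ _ hkl _ hx =>
  mem_seminormBox_restrict.2 fun i hi => mem_seminormBox_restrict.1 hx i (hi.trans_le hkl)

variable [TopologicalSpace E]

/-- The sequence `p` of continuous seminorms is fundamental: every continuous seminorm is dominated
by a multiple of a single member. -/
structure IsFundamentalSeq (p : ℕ → Seminorm 𝕜 E) : Prop where
  continuous : ∀ n, Continuous (p n)
  exists_le : ∀ q : Seminorm 𝕜 E, Continuous q → ∃ n, ∃ C : ℝ, 0 ≤ C ∧ ∀ x, q x ≤ C * p n x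

variable [PolynormableSpace 𝕜 E]

theorem exists_isFundamentalSeq [FirstCountableTopology E] :
    ∃ p : ℕ → Seminorm 𝕜 E, IsFundamentalSeq p := by
  obtain ⟨U, hU⟩ := (𝓝 (0 : E)).exists_antitone_basis
  have := (PolynormableSpace.withSeminorms 𝕜 E).topologicalAddGroup
  have key : ∀ n, ∃ q : Seminorm 𝕜 E, Continuous q ∧ ∃ r > 0, {x | q x < r} ⊆ U n := fun n => by
    obtain ⟨s, r, hr, hs⟩ :=
      (PolynormableSpace.withSeminorms 𝕜 E).mem_nhds_iff 0 (U n) |>.1 (hU.mem n)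
    exact ⟨_, Seminorm.continuous_finsetSup fun (i : {p : Seminorm 𝕜 E // Continuous p}) _ => i.2,
      r, hr, by rwa [← Seminorm.ball_zero_eq]⟩
  choose p hpc r hr hp using key
  refine ⟨p, hpc, fun q hq => ?_⟩
  obtain ⟨n, -, hn⟩ := hU.1.mem_iff.1
    ((isOpen_lt hq continuous_const : IsOpen {x | q x < 1}).mem_nhds (by simp))
  -- Homogeneity: as `{p n < r n} ⊆ {q < 1}`, every `t > p n x / r n` satisfies `q x < t`.
  refine ⟨n, (r n)⁻¹, (inv_pos.2 (hr n)).le,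
    fun x => le_of_forall_gt_imp_ge_of_dense fun t ht => ?_⟩
  have ht0 : 0 < t := (mul_nonneg (inv_pos.2 (hr n)).le (apply_nonneg _ _)).trans_lt ht
  have h1 : q (((t⁻¹ : ℝ) : 𝕜) • x) < 1 := hn (hp n (by
    rw [mem_ofPred_eq, map_smul_eq_mul, RCLike.norm_ofReal, abs_of_pos (inv_pos.2 ht0)]
    rwa [inv_mul_lt_iff₀ ht0, mul_comm, ← inv_mul_lt_iff₀ (hr n)]))
  rw [map_smul_eq_mul, RCLike.norm_ofReal, abs_of_pos (inv_pos.2 ht0), inv_mul_lt_iff₀ ht0] at h1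
  linarith

theorem IsFundamentalSeq.isVonNBounded_iff {p : ℕ → Seminorm 𝕜 E} (hp : IsFundamentalSeq p)
    {S : Set E} : IsVonNBounded 𝕜 S ↔ ∀ n, ∃ M, ∀ x ∈ S, p n x ≤ M := by
  have := (PolynormableSpace.withSeminorms 𝕜 E).isVonNBounded_iff_seminorm_bddAbove (s := S)
  rw [this]
  constructor
  · intro h n
    obtain ⟨M, hM⟩ := h ⟨p n, hp.continuous n⟩
    exact ⟨M, fun x hx => hM ⟨x, hx, rfl⟩⟩
  · rintro h ⟨q, hq⟩
    obtain ⟨n, C, hC, hn⟩ := hp.exists_le q hq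
    obtain ⟨M, hM⟩ := h n
    refine ⟨C * M, ?_⟩
    rintro _ ⟨x, hx, rfl⟩
    exact (hn x).trans (mul_le_mul_of_nonneg_left (hM x hx) hC)

/-- A sequence whose `k`-th term satisfies the first `k` constraints is bounded: each seminorm is
controlled on all but finitely many terms. -/
theorem IsFundamentalSeq.isVonNBounded_range {p : ℕ → Seminorm 𝕜 E} (hp : IsFundamentalSeq p)
    {α : ℕ → ℕ} {x : ℕ → E} (hx : ∀ k, x k ∈ seminormBox p (fun i : Fin k => α i)) :
    IsVonNBounded 𝕜 (range x) := by
  refine hp.isVonNBounded_iff.2 fun n => ⟨(α n + 1) + ∑ k ∈ Finset.range (n + 1), p n (x k), ?_⟩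
  rintro _ ⟨k, rfl⟩
  have hs : 0 ≤ ∑ k ∈ Finset.range (n + 1), p n (x k) := Finset.sum_nonneg fun _ _ => by positivity
  by_cases hk : n < k
  · linarith [mem_seminormBox_restrict.1 (hx k) n hk]
  · have := Finset.single_le_sum (f := fun k => p n (x k)) (s := Finset.range (n + 1))
      (fun _ _ => by positivity) (Finset.mem_range.2 (by omega : k < n + 1))
    have h0 : (0 : ℝ) ≤ α n + 1 := by positivity
    linarith

/-- A subset of a polynormable space on which every continuous linear functional is bounded is
von Neumann bounded (Mackey). -/
theorem isVonNBounded_of_forall_dual {S : Set E}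
    (h : ∀ f : StrongDual 𝕜 E, ∃ M, ∀ x ∈ S, ‖f x‖ ≤ M) : IsVonNBounded 𝕜 S := by
  refine (PolynormableSpace.withSeminorms 𝕜 E).isVonNBounded_iff_seminorm_bddAbove.2 fun q => ?_
  obtain ⟨M, hM⟩ := q.1.exists_bound_of_forall_dual (S := S) fun f ⟨C, hC⟩ => by
    refine h ⟨f, ?_⟩
    refine (PolynormableSpace.withSeminorms 𝕜 E).continuous_normedSpace_rng 𝕜 f
      ⟨{q}, C.toNNReal, fun x => ?_⟩
    have := (hC x).trans (mul_le_mul_of_nonneg_right (Real.le_coe_toNNReal C) (apply_nonneg q.1 x))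
    simpa [NNReal.smul_def] using this
  exact ⟨M, by rintro _ ⟨x, hx, rfl⟩; exact hM x hx⟩

theorem exists_dual_eq_seminorm {q : Seminorm 𝕜 E} (hq : Continuous q) (x : E) :
    ∃ g : StrongDual 𝕜 E, g x = (q x : 𝕜) ∧ ∀ y, ‖g y‖ ≤ q y := by
  rcases eq_or_ne (q x) 0 with h0 | h0
  · exact ⟨0, by simp [h0], by simp⟩
  have hx : x ≠ 0 := by rintro rfl; simp at h0
  obtain ⟨g, hg, hgq⟩ := Module.Dual.exists_continuous_extension_of_le_seminorm (𝕜 := 𝕜)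
    (𝕜 ∙ x) ((q x : 𝕜) • (LinearEquiv.coord 𝕜 E x hx)) hq (by
      intro y
      rw [LinearMap.smul_apply, norm_smul, RCLike.norm_ofReal, abs_of_nonneg (apply_nonneg q x)]
      conv_rhs => rw [← LinearEquiv.coord_apply_smul 𝕜 E x hx y, map_smul_eq_mul, mul_comm]
      rfl)
  refine ⟨g, ?_, hgq⟩
  have := hg ⟨x, Submodule.mem_span_singleton_self x⟩
  simpa [LinearEquiv.coord_self, RCLike.real_smul_eq_coe_mul] using this

theorem PolynormableSpace.separatingDual [T1Space E] : SeparatingDual 𝕜 E := by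
  refine ⟨fun x hx => ?_⟩
  obtain ⟨q, hq⟩ := (PolynormableSpace.withSeminorms 𝕜 E).separating_of_T1 x hx
  obtain ⟨g, hg, -⟩ := exists_dual_eq_seminorm q.2 x
  exact ⟨g, by simpa [hg] using hq⟩

end Seminorms

/-! ### Locally finite families in the weak topology -/

section Reflexive

variable {𝕜 E : Type*} [RCLike 𝕜] [AddCommGroup E] [Module 𝕜 E] [TopologicalSpace E]

theorem WeakSpace.continuous_eval (f : StrongDual 𝕜 E) :
    Continuous fun x : WeakSpace 𝕜 E => f ((toWeakSpace 𝕜 E).symm x) :=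
  WeakBilin.eval_continuous (topDualPairing 𝕜 E).flip f

theorem WeakSpace.tendsto_nhds_iff {ι : Type*} {l : Filter ι} {u : ι → WeakSpace 𝕜 E}
    {x : WeakSpace 𝕜 E} : Tendsto u l (𝓝 x) ↔ ∀ f : StrongDual 𝕜 E,
      Tendsto (fun i => f ((toWeakSpace 𝕜 E).symm (u i))) l (𝓝 (f ((toWeakSpace 𝕜 E).symm x))) := by
  have h : IsInducing fun (x : WeakSpace 𝕜 E) (f : StrongDual 𝕜 E) =>
    f ((toWeakSpace 𝕜 E).symm x) := ⟨rfl⟩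
  rw [h.tendsto_nhds_iff, tendsto_pi_nhds]
  rfl

theorem WeakSpace.eq_generateFrom : (inferInstance : TopologicalSpace (WeakSpace 𝕜 E)) =
    TopologicalSpace.generateFrom {s | ∃ (f : StrongDual 𝕜 E) (V : Set 𝕜), IsOpen V ∧
      (fun x : WeakSpace 𝕜 E => f ((toWeakSpace 𝕜 E).symm x)) ⁻¹' V = s} := by
  refine le_antisymm (le_generateFrom ?_) ?_
  · rintro _ ⟨f, V, hV, rfl⟩
    exact hV.preimage (WeakSpace.continuous_eval f)
  · refine (continuous_iff_le_induced (t₁ := TopologicalSpace.generateFrom _)).1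
      (@continuous_pi _ _ _ (TopologicalSpace.generateFrom _) _ _ fun f =>
        @Continuous.mk _ _ (TopologicalSpace.generateFrom _) _ _ fun V hV => ?_)
    exact TopologicalSpace.isOpen_generateFrom_of_mem ⟨f, V, hV, rfl⟩

theorem Bornology.IsVonNBounded.setOf_forall_norm_lt_mem_nhds {S : Set E}
    (hS : IsVonNBounded 𝕜 S) {ε : ℝ} (hε : 0 < ε) :
    {f : StrongDual 𝕜 E | ∀ x ∈ S, ‖f x‖ < ε} ∈ 𝓝 0 := by
  filter_upwards [ContinuousLinearMap.eventually_nhds_zero_mapsTo (F := 𝕜) (σ := RingHom.id 𝕜) hS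
    (Metric.ball_mem_nhds 0 hε)] with f hf x hx
  simpa using hf hx

theorem Bornology.IsVonNBounded.exists_norm_apply_le {S : Set E} (hS : IsVonNBounded 𝕜 S)
    (f : StrongDual 𝕜 E) : ∃ M, ∀ x ∈ S, ‖f x‖ ≤ M := by
  obtain ⟨M, hM⟩ := (NormedSpace.isVonNBounded_iff' 𝕜).1 (hS.image f)
  exact ⟨M, fun x hx => hM _ ⟨x, hx, rfl⟩⟩

variable [ContinuousSMul 𝕜 E]

theorem IsReflexiveLCS.exists_eval_eq (hE : IsReflexiveLCS 𝕜 E)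
    (Φ : StrongDual 𝕜 (StrongDual 𝕜 E)) : ∃ x : E, ∀ f, Φ f = f x := by
  obtain ⟨x, rfl⟩ := hE.surjective Φ
  exact ⟨x, fun _ => rfl⟩

/-- Bounded subsets of a reflexive space are relatively weakly compact: the pointwise limit along
an ultrafilter is a functional on the dual that is bounded on the polar of the set, hence
strongly continuous, hence an evaluation. -/
theorem IsReflexiveLCS.exists_tendsto_ultrafilter (hE : IsReflexiveLCS 𝕜 E) {ι : Type*}
    {u : ι → E} (hu : IsVonNBounded 𝕜 (range u)) (l : Ultrafilter ι) :
    ∃ x : E, ∀ f : StrongDual 𝕜 E, Tendsto (fun i => f (u i)) l (𝓝 (f x)) := by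
  have key : ∀ f : StrongDual 𝕜 E, ∃ c : 𝕜, Tendsto (fun i => f (u i)) l (𝓝 c) := fun f => by
    obtain ⟨M, hM⟩ := IsVonNBounded.exists_norm_apply_le hu f
    obtain ⟨c, -, hc⟩ := (isCompact_closedBall (0 : 𝕜) M).ultrafilter_le_nhds
      (l.map fun i => f (u i)) (tendsto_principal.2 (Eventually.of_forall fun i => by
        simpa using hM _ ⟨i, rfl⟩))
    exact ⟨c, hc⟩
  choose Φ hΦ using key
  let Φ' : StrongDual 𝕜 E →ₗ[𝕜] 𝕜 :=
    { toFun := Φ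
      map_add' := fun f g => tendsto_nhds_unique (hΦ (f + g)) ((hΦ f).add (hΦ g))
      map_smul' := fun c f => tendsto_nhds_unique (hΦ (c • f)) ((hΦ f).const_smul c) }
  have hcont : Continuous Φ' := by
    refine continuous_of_continuousAt_zero Φ' ?_
    rw [ContinuousAt, map_zero, Metric.nhds_basis_closedBall.tendsto_right_iff]
    intro ε hε
    filter_upwards [IsVonNBounded.setOf_forall_norm_lt_mem_nhds hu hε] with f hf
    rw [mem_closedBall_zero_iff]
    exact le_of_tendsto (hΦ f).norm (Eventually.of_forall fun i => (hf _ ⟨i, rfl⟩).le)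
  obtain ⟨x, hx⟩ := hE.exists_eval_eq ⟨Φ', hcont⟩
  exact ⟨x, fun f => hx f ▸ hΦ f⟩

variable [PolynormableSpace 𝕜 E] {p : ℕ → Seminorm 𝕜 E}

/-- Some box of `α` meets only finitely many members of a locally finite family. -/
theorem IsReflexiveLCS.exists_finite_meets (hE : IsReflexiveLCS 𝕜 E) (hp : IsFundamentalSeq p)
    {D : Set (Set (WeakSpace 𝕜 E))} (hD : LocallyFinite fun s : D => (s : Set (WeakSpace 𝕜 E)))
    (α : ℕ → ℕ) : ∃ k, {s ∈ D | ∃ x ∈ seminormBox p (fun i : Fin k => α i),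
      toWeakSpace 𝕜 E x ∈ s}.Finite := by
  by_contra! h
  have hstep : ∀ (k : ℕ) (F : Finset (Set (WeakSpace 𝕜 E))), ∃ s ∈ D, s ∉ F ∧
      ∃ x ∈ seminormBox p (fun i : Fin k => α i), toWeakSpace 𝕜 E x ∈ s := fun k F => by
    obtain ⟨s, ⟨hs, hx⟩, hF⟩ := Set.Infinite.exists_notMem_finset (h k) F
    exact ⟨s, hs, hF, hx⟩
  classical
  obtain ⟨s, hs⟩ : ∃ s : ℕ → Set (WeakSpace 𝕜 E), Function.Injective s ∧ ∀ k, s k ∈ D ∧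
      ∃ x ∈ seminormBox p (fun i : Fin k => α i), toWeakSpace 𝕜 E x ∈ s k := by
    -- The indices of the boxes are chosen strictly increasing, so that the `k`-th is at least `k`.
    obtain ⟨q, hq, hr⟩ := exists_seq_of_forall_finset_exists
      (fun q : ℕ × Set (WeakSpace 𝕜 E) => q.2 ∈ D ∧
        ∃ x ∈ seminormBox p (fun i : Fin q.1 => α i), toWeakSpace 𝕜 E x ∈ q.2)
      (fun q q' => q.1 < q'.1 ∧ q.2 ≠ q'.2) fun T _ => by
        obtain ⟨s, hs, hsT, hx⟩ := hstep (T.sup Prod.fst + 1) (T.image Prod.snd)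
        refine ⟨(T.sup Prod.fst + 1, s), ⟨hs, hx⟩, fun q hq => ⟨?_, ?_⟩⟩
        · exact Nat.lt_succ_of_le (Finset.le_sup (f := Prod.fst) hq)
        · rintro rfl
          exact hsT (Finset.mem_image_of_mem _ hq)
    have hmono : StrictMono fun n => (q n).1 := fun m n hmn => (hr m n hmn).1
    refine ⟨fun n => (q n).2, fun m n hmn => ?_, fun k => ?_⟩
    · rcases lt_trichotomy m n with h | h | h
      exacts [((hr m n h).2 hmn).elim, h, ((hr n m h).2 hmn.symm).elim]
    obtain ⟨hD', x, hx, hxs⟩ := hq k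
    exact ⟨hD', x, seminormBox_restrict_antitone p α (hmono.le_apply (x := k)) hx, hxs⟩
  obtain ⟨hinj, hs⟩ := hs
  choose hsD x hx hxs using hs
  obtain ⟨y, hy⟩ := hE.exists_tendsto_ultrafilter (hp.isVonNBounded_range hx) (hyperfilter ℕ)
  obtain ⟨t, ht, hfin⟩ := hD (toWeakSpace 𝕜 E y)
  have hev : ∀ᶠ k in (hyperfilter ℕ : Filter ℕ), toWeakSpace 𝕜 E (x k) ∈ t :=
    (WeakSpace.tendsto_nhds_iff.2 hy : Tendsto (fun k => toWeakSpace 𝕜 E (x k)) _ (𝓝 _)) ht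
  have hinf : {k | toWeakSpace 𝕜 E (x k) ∈ t}.Infinite := fun hf =>
    (hf.notMem_hyperfilter) hev
  refine hinf (Set.Finite.of_injOn (f := fun k => (⟨s k, hsD k⟩ : D)) (fun k hk => ?_)
    (fun a _ b _ hab => hinj (congrArg Subtype.val hab)) hfin)
  exact ⟨_, hxs k, hk⟩

/-- In the weak topology of a metrizable reflexive space, locally finite families are countable;
this is the form in which the weak Lindelöf property is used. -/
theorem IsReflexiveLCS.countable_of_locallyFinite (hE : IsReflexiveLCS 𝕜 E)
    (hp : IsFundamentalSeq p) {D : Set (Set (WeakSpace 𝕜 E))}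
    (hD : LocallyFinite fun s : D => (s : Set (WeakSpace 𝕜 E))) : D.Countable := by
  let G (q : Σ k, Fin k → ℕ) : Set (Set (WeakSpace 𝕜 E)) :=
    {s ∈ D | ∃ x ∈ seminormBox p q.2, toWeakSpace 𝕜 E x ∈ s}
  refine ((countable_iUnion fun q : {q // (G q).Finite} => q.2.countable).union
    (countable_singleton ∅)).mono fun s hs => ?_
  rcases s.eq_empty_or_nonempty with rfl | ⟨x, hx⟩
  · exact Or.inr rfl
  obtain ⟨k, hk⟩ := hE.exists_finite_meets hp hD
    fun i => ⌈p i ((toWeakSpace 𝕜 E).symm x)⌉₊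
  refine Or.inl (mem_iUnion.2 ⟨⟨⟨k, _⟩, hk⟩, hs, (toWeakSpace 𝕜 E).symm x, fun i => ?_, by simpa⟩)
  exact (Nat.le_ceil (p i ((toWeakSpace 𝕜 E).symm x))).trans (lt_add_one _).le

theorem IsReflexiveLCS.isWeaklyAlephZeroSpace (hE : IsReflexiveLCS 𝕜 E)
    (hp : IsFundamentalSeq p) (h : IsWeaklyAlephSpace 𝕜 E) : IsWeaklyAlephZeroSpace 𝕜 E := by
  obtain ⟨hT, N, ⟨D, hD, rfl⟩, hN⟩ := h
  exact ⟨hT, _, countable_iUnion fun n => hE.countable_of_locallyFinite hp (hD n), hN⟩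

end Reflexive

/-! ### A countable network in the strong dual -/

section StrongDual

variable {𝕜 E : Type*} [RCLike 𝕜] [AddCommGroup E] [Module 𝕜 E] [TopologicalSpace E]

/-- The functionals bounded by `r` on the box `seminormBox p a`. -/
def dualTube (p : ℕ → Seminorm 𝕜 E) {k : ℕ} (a : Fin k → ℕ) (r : ℝ) : Set (StrongDual 𝕜 E) :=
  {f | ∀ x ∈ seminormBox p a, ‖f x‖ ≤ r}

variable [PolynormableSpace 𝕜 E] {p : ℕ → Seminorm 𝕜 E}

theorem exists_countable_separating_dual [T1Space E] [SecondCountableTopology E] :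
    ∃ L : Set (StrongDual 𝕜 E), L.Countable ∧ ∀ x, (∀ f ∈ L, f x = 0) → x = 0 := by
  have := PolynormableSpace.separatingDual (𝕜 := 𝕜) (E := E)
  -- The open sets `{x | f x ≠ 0}` cover the complement of `0`, which is Lindelöf.
  obtain ⟨L, hL, hLU⟩ := TopologicalSpace.isOpen_iUnion_countable
    (fun f : StrongDual 𝕜 E => {x | f x ≠ 0}) fun f => isOpen_ne_fun f.continuous continuous_const
  refine ⟨L, hL, fun x hx => by_contra fun h0 => ?_⟩
  obtain ⟨f, hf⟩ := SeparatingDual.exists_ne_zero (R := 𝕜) h0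
  have : x ∈ ⋃ f : StrongDual 𝕜 E, {x | f x ≠ 0} := mem_iUnion.2 ⟨f, hf⟩
  rw [← hLU] at this
  obtain ⟨g, hg, hgx⟩ := mem_iUnion₂.1 this
  exact hgx (hx g hg)

/-- A functional outside all tubes of radius `2` exceeds `2` at some point `x k` of each box. The
sequence `x` is bounded, and a functional within `1` of the given one on `x` is in no tube of
radius `1`. -/
theorem closure_iUnion_dualTube_subset (hp : IsFundamentalSeq p) (α : ℕ → ℕ) :
    closure (⋃ k, dualTube p (fun i : Fin k => α i) 1) ⊆
      ⋃ k, dualTube p (fun i : Fin k => α i) 2 := by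
  intro f hf
  by_contra h
  simp only [dualTube, mem_iUnion, mem_ofPred_eq, not_exists, not_forall, not_le] at h
  choose x hx hfx using h
  have hW := IsVonNBounded.setOf_forall_norm_lt_mem_nhds (hp.isVonNBounded_range hx) one_pos
  have hW' : {g : StrongDual 𝕜 E | ∀ y ∈ range x, ‖(g - f) y‖ < 1} ∈ 𝓝 f := by
    have : Tendsto (fun g => g - f) (𝓝 f) (𝓝 (0 : StrongDual 𝕜 E)) := by
      simpa using (continuous_sub_right f).tendsto f
    exact this hW
  obtain ⟨g, hgW, hgV⟩ := mem_closure_iff_nhds.1 hf _ hW'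
  obtain ⟨k, hk⟩ := mem_iUnion.1 hgV
  have h1 := hk (x k) (hx k)
  have h2 := hgW (x k) ⟨k, rfl⟩
  have h3 := norm_sub_le (g (x k)) ((g - f) (x k))
  rw [sub_apply, sub_sub_cancel] at h3
  rw [sub_apply] at h2
  linarith [hfx k]

variable [ContinuousSMul 𝕜 E]

/-- The polar of the intersection of all boxes of `α` lies in the strong closure of the union of the
tubes of radius `1`: by reflexivity a separating functional would be the evaluation at a point,
and a multiple of this point would belong to the intersection of the boxes. -/
theorem IsReflexiveLCS.subset_closure_iUnion_dualTube (hE : IsReflexiveLCS 𝕜 E)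
    (hp : IsFundamentalSeq p) (α : ℕ → ℕ) :
    {f : StrongDual 𝕜 E | ∀ x, (∀ i, p i x ≤ α i + 1) → ‖f x‖ ≤ 1} ⊆
      closure (⋃ k, dualTube p (fun i : Fin k => α i) 1) := by
  intro f hf
  by_contra hfV
  have hmono : Monotone fun k => dualTube p (fun i : Fin k => α i) 1 := fun k l hkl g hg x hx =>
    hg x (seminormBox_restrict_antitone p α hkl hx)
  have hconv : Convex ℝ (⋃ k, dualTube p (fun i : Fin k => α i) 1) := by
    refine (hmono.directed_le).convex_iUnion fun {k} => ?_
    intro g hg h hh s t hs ht hst x hx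
    calc ‖(s • g + t • h) x‖ ≤ ‖s • g x‖ + ‖t • h x‖ := norm_add_le _ _
      _ ≤ s * 1 + t * 1 := by
        rw [norm_smul, norm_smul, Real.norm_of_nonneg hs, Real.norm_of_nonneg ht]
        gcongr
        exacts [hg x hx, hh x hx]
      _ = 1 := by linarith
  obtain ⟨Φ, u, hΦ, hu⟩ := RCLike.geometric_hahn_banach_closed_point (𝕜 := 𝕜)
    hconv.closure isClosed_closure hfV
  obtain ⟨x, hx⟩ := hE.exists_eval_eq Φ
  have hV : ∀ g ∈ ⋃ k, dualTube p (fun i : Fin k => α i) 1, RCLike.re (g x) < u := fun g hg => by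
    rw [← hx]; exact hΦ g (subset_closure hg)
  have hu0 : 0 < u := by
    simpa using hV 0 (mem_iUnion.2 ⟨0, fun y _ => by simp⟩)
  have hpx : ∀ i, p i x ≤ (α i + 1) * u := fun i => by
    obtain ⟨g, hgx, hg⟩ := exists_dual_eq_seminorm (hp.continuous i) x
    have hα : (0 : ℝ) < α i + 1 := by positivity
    -- A functional dominated by `p i` and scaled by `(α i + 1)⁻¹` is bounded by `1` on the box
    -- constraining the first `i + 1` seminorms.
    have := hV ((((α i + 1 : ℝ)⁻¹ : ℝ) : 𝕜) • g) (mem_iUnion.2 ⟨i + 1, fun y hy => by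
      rw [smul_apply, norm_smul, RCLike.norm_ofReal,
        abs_of_pos (inv_pos.2 hα), inv_mul_le_iff₀ hα, mul_one]
      exact (hg y).trans (mem_seminormBox_restrict.1 hy i (Nat.lt_succ_self i))⟩)
    rw [smul_apply, hgx, smul_eq_mul, ← RCLike.ofReal_mul, RCLike.ofReal_re,
      inv_mul_lt_iff₀ hα] at this
    exact this.le
  have h1 := hf (((u⁻¹ : ℝ) : 𝕜) • x) fun i => by
    rw [map_smul_eq_mul, RCLike.norm_ofReal, abs_of_pos (inv_pos.2 hu0), inv_mul_le_iff₀ hu0,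
      mul_comm]
    exact hpx i
  rw [map_smul, norm_smul, RCLike.norm_ofReal, abs_of_pos (inv_pos.2 hu0), inv_mul_le_iff₀ hu0,
    mul_one] at h1
  rw [hx] at hu
  exact (hu.trans_le ((RCLike.re_le_norm _).trans h1)).false

theorem IsReflexiveLCS.iUnion_dualTube_mem_nhds (hE : IsReflexiveLCS 𝕜 E)
    (hp : IsFundamentalSeq p) (α : ℕ → ℕ) :
    ⋃ k, dualTube p (fun i : Fin k => α i) 2 ∈ 𝓝 (0 : StrongDual 𝕜 E) := by
  have hB : IsVonNBounded 𝕜 {x | ∀ i, p i x ≤ α i + 1} :=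
    hp.isVonNBounded_iff.2 fun i => ⟨_, fun x hx => hx i⟩
  refine mem_of_superset (IsVonNBounded.setOf_forall_norm_lt_mem_nhds hB one_pos) fun f hf => ?_
  exact closure_iUnion_dualTube_subset hp α
    (hE.subset_closure_iUnion_dualTube hp α fun x hx => (hf x hx).le)

theorem IsReflexiveLCS.separableSpace_strongDual [T1Space E] [SecondCountableTopology E]
    (hE : IsReflexiveLCS 𝕜 E) : TopologicalSpace.SeparableSpace (StrongDual 𝕜 E) := by
  obtain ⟨L, hL, hL0⟩ := exists_countable_separating_dual (𝕜 := 𝕜) (E := E)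
  have hdense : closure (Submodule.span 𝕜 L : Set (StrongDual 𝕜 E)) = univ := by
    refine eq_univ_of_forall fun f => by_contra fun hf => ?_
    have hconv : Convex ℝ (Submodule.span 𝕜 L : Set (StrongDual 𝕜 E)) :=
      ((Submodule.span 𝕜 L).restrictScalars ℝ).convex
    obtain ⟨Φ, u, hΦ, hu⟩ := RCLike.geometric_hahn_banach_closed_point (𝕜 := 𝕜)
      hconv.closure isClosed_closure hf
    obtain ⟨x, hx⟩ := hE.exists_eval_eq Φ
    have h0 : ∀ g ∈ Submodule.span 𝕜 L, Φ g = 0 := fun g hg => by_contra fun hg0 => by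
      -- `Φ` is bounded above on a subspace, hence vanishes there.
      have := hΦ (((u : 𝕜) / Φ g) • g) (subset_closure (Submodule.smul_mem _ _ hg))
      rw [map_smul, smul_eq_mul, div_mul_cancel₀ _ hg0, RCLike.ofReal_re] at this
      exact this.false
    have hx0 : x = 0 := hL0 x fun g hg => by rw [← hx]; exact h0 g (Submodule.subset_span hg)
    have h1 := hΦ 0 (subset_closure (Submodule.zero_mem _))
    rw [hx, hx0, map_zero, map_zero] at hu
    rw [map_zero, map_zero] at h1
    exact (h1.trans hu).false
  have := (hL.isSeparable.span (R := 𝕜)).closure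
  rw [hdense] at this
  exact TopologicalSpace.isSeparable_univ_iff.1 this

theorem IsReflexiveLCS.exists_countable_network_strongDual [T1Space E] [SecondCountableTopology E]
    (hE : IsReflexiveLCS 𝕜 E) (hp : IsFundamentalSeq p) :
    ∃ P : Set (Set (StrongDual 𝕜 E)), P.Countable ∧
      ∀ f, ∀ W ∈ 𝓝 f, ∃ A ∈ P, f ∈ A ∧ A ⊆ W := by
  have := hE.separableSpace_strongDual
  obtain ⟨G, hGc, hGd⟩ := TopologicalSpace.exists_countable_dense (StrongDual 𝕜 E)
  have := hGc.to_subtype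
  refine ⟨range fun q : G × Σ k, Fin k → ℕ => {f | f - q.1 ∈ dualTube p q.2.2 2},
    countable_range _, fun f W hW => ?_⟩
  have hW0 : {h | f + h ∈ W} ∈ 𝓝 (0 : StrongDual 𝕜 E) :=
    (continuous_const_add f).tendsto 0 (by simpa using hW)
  obtain ⟨⟨S, ε⟩, ⟨hS, hε⟩, hSW⟩ := (ContinuousLinearMap.hasBasis_nhds_zero_of_basis
    (σ := RingHom.id 𝕜) (E := E) Metric.nhds_basis_ball).mem_iff.1 hW0
  choose M hM using hp.isVonNBounded_iff.1 hS
  have hc : 0 < 5 / ε := div_pos (by norm_num) hε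
  -- The boxes of this `α` contain `(5 / ε) • S`, and two functionals in one translated tube of
  -- radius `2` differ by at most `4` on its box, hence by less than `ε` on `S`.
  let α : ℕ → ℕ := fun i => ⌈5 / ε * M i⌉₊
  have hT : {g | f - g ∈ ⋃ k, dualTube p (fun i : Fin k => α i) 2} ∈ 𝓝 f :=
    (continuous_sub_left f).tendsto f (by simpa using hE.iUnion_dualTube_mem_nhds hp α)
  obtain ⟨g, hgT, hgG⟩ := mem_closure_iff_nhds.1 (hGd f) _ hT
  obtain ⟨k, hk⟩ := mem_iUnion.1 hgT
  refine ⟨_, ⟨(⟨g, hgG⟩, ⟨k, fun i => α i⟩), rfl⟩, hk, fun h hh => ?_⟩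
  have hmem : h - f ∈ {h | f + h ∈ W} := hSW fun x hx => by
    have hbox : ((5 / ε : ℝ) : 𝕜) • x ∈ seminormBox p (fun i : Fin k => α i) := fun i => by
      rw [map_smul_eq_mul, RCLike.norm_ofReal, abs_of_pos hc]
      calc 5 / ε * p i x ≤ 5 / ε * M i := mul_le_mul_of_nonneg_left (hM i x hx) hc.le
        _ ≤ α i := Nat.le_ceil _
        _ ≤ α i + 1 := (lt_add_one _).le
    have h1 := norm_sub_le ((h - g) (((5 / ε : ℝ) : 𝕜) • x)) ((f - g) (((5 / ε : ℝ) : 𝕜) • x))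
    rw [← sub_apply, sub_sub_sub_cancel_right, map_smul, norm_smul, RCLike.norm_ofReal,
      abs_of_pos hc] at h1
    have h2 : 5 / ε * ‖(h - f) x‖ ≤ 4 := by linarith [hh _ hbox, hk _ hbox]
    rw [div_mul_eq_mul_div, div_le_iff₀ hε] at h2
    rw [mem_ball_zero_iff]
    linarith
  simpa using hmem

end StrongDual

/-! ### `k`-networks in the weak topology -/

section Weak

variable {𝕜 E : Type*} [RCLike 𝕜] [AddCommGroup E] [Module 𝕜 E] [TopologicalSpace E]
  [PolynormableSpace 𝕜 E]

/-- Weakly compact sets are bounded in the original topology. -/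
theorem WeakSpace.isVonNBounded_of_isCompact {K : Set (WeakSpace 𝕜 E)} (hK : IsCompact K) :
    IsVonNBounded 𝕜 ((toWeakSpace 𝕜 E) ⁻¹' K) := by
  refine isVonNBounded_of_forall_dual fun f => ?_
  obtain ⟨M, hM⟩ := hK.exists_bound_of_continuousOn (WeakSpace.continuous_eval f).continuousOn
  exact ⟨M, fun x hx => hM (toWeakSpace 𝕜 E x) hx⟩

theorem WeakSpace.t3Space [IsTopologicalAddGroup E] [T1Space E] : T3Space (WeakSpace 𝕜 E) := by
  have := PolynormableSpace.separatingDual (𝕜 := 𝕜) (E := E)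
  have : T2Space (WeakSpace 𝕜 E) := ⟨fun x y hxy => by
    obtain ⟨f, hf⟩ := SeparatingDual.exists_separating_of_ne (R := 𝕜)
      ((toWeakSpace 𝕜 E).symm.injective.ne hxy)
    exact separated_by_continuous (WeakSpace.continuous_eval f) hf⟩
  infer_instance

/-- A countable network of the strong dual yields a countable `k`-network of the weak topology. Only
the subbasic weakly open sets `f ⁻¹' V` have to be considered, and a weakly compact `K ⊆ f ⁻¹' V` is
handled by a network element around `f` inside the strong neighbourhood `{g | g '' K ⊆ O}`. -/
theorem exists_countable_isKNetwork_weakSpace [IsTopologicalAddGroup E]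
    {P : Set (Set (StrongDual 𝕜 E))} (hP : P.Countable)
    (hPn : ∀ f, ∀ W ∈ 𝓝 f, ∃ A ∈ P, f ∈ A ∧ A ⊆ W) :
    ∃ N : Set (Set (WeakSpace 𝕜 E)), N.Countable ∧ IsKNetwork N := by
  obtain ⟨B, hB, hBo, hBK⟩ := exists_countable_isOpen_interpolation 𝕜
  refine exists_countable_isKNetwork_of_subbase WeakSpace.eq_generateFrom
    (M := image2 (fun A O => {x | ∀ g ∈ A, g ((toWeakSpace 𝕜 E).symm x) ∈ O}) P B)
    (hP.image2 hB _) ?_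
  rintro _ ⟨f, V, hV, rfl⟩ K hK hKV
  have hfK : IsCompact ((fun x : WeakSpace 𝕜 E => f ((toWeakSpace 𝕜 E).symm x)) '' K) :=
    hK.image (WeakSpace.continuous_eval f)
  obtain ⟨O, hO, hKO, hOV⟩ := hBK _ V hfK hV (image_subset_iff.2 hKV)
  obtain ⟨ε, hε, hεO⟩ := hfK.exists_thickening_subset_open (hBo O hO) hKO
  have hW : {g : StrongDual 𝕜 E | ∀ x ∈ (toWeakSpace 𝕜 E) ⁻¹' K, ‖(g - f) x‖ < ε} ∈ 𝓝 f :=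
    (continuous_sub_right f).tendsto f (by
      simpa using IsVonNBounded.setOf_forall_norm_lt_mem_nhds
        (WeakSpace.isVonNBounded_of_isCompact hK) hε)
  obtain ⟨A, hA, hfA, hAW⟩ := hPn f _ hW
  refine ⟨_, ⟨A, hA, O, hO, rfl⟩, fun x hx g hg => hεO ?_, fun x hx => hOV (hx f hfA)⟩
  refine Metric.mem_thickening_iff.2 ⟨_, ⟨x, hx, rfl⟩, ?_⟩
  rw [dist_eq_norm, ← sub_apply]
  exact hAW hg _ (by simpa using hx)

theorem IsReflexiveLCS.isWeaklyAlephZeroSpace_of_secondCountable [ContinuousSMul 𝕜 E]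
    [IsTopologicalAddGroup E] [T1Space E] [SecondCountableTopology E] (hE : IsReflexiveLCS 𝕜 E)
    {p : ℕ → Seminorm 𝕜 E} (hp : IsFundamentalSeq p) :
    IsWeaklyAlephZeroSpace 𝕜 E := by
  obtain ⟨P, hP, hPn⟩ := hE.exists_countable_network_strongDual hp
  exact ⟨WeakSpace.t3Space, exists_countable_isKNetwork_weakSpace hP hPn⟩

end Weak

/-! ### The equivalence -/

theorem IsWeaklyAlephZeroSpace.separableSpace {𝕜 E : Type*} [RCLike 𝕜] [AddCommGroup E]
    [Module 𝕜 E] [Module ℝ E] [IsScalarTower ℝ 𝕜 E] [TopologicalSpace E] [IsTopologicalAddGroup E]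
    [ContinuousSMul 𝕜 E] [LocallyConvexSpace ℝ E] (h : IsWeaklyAlephZeroSpace 𝕜 E) :
    TopologicalSpace.SeparableSpace E := by
  obtain ⟨-, N, hNc, hN⟩ := h
  have := hN.separableSpace hNc
  obtain ⟨D, hDc, hD⟩ := TopologicalSpace.exists_countable_dense (WeakSpace 𝕜 E)
  let M := Submodule.span 𝕜 ((toWeakSpace 𝕜 E) ⁻¹' D)
  have hDM : D ⊆ toWeakSpace 𝕜 E '' M := fun x hx =>
    ⟨(toWeakSpace 𝕜 E).symm x, Submodule.subset_span (by simpa using hx), by simp⟩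
  have hM : closure (M : Set E) = univ := by
    have := (M.restrictScalars ℝ).convex.toWeakSpace_closure 𝕜
    rw [Submodule.coe_restrictScalars, (hD.mono hDM).closure_eq] at this
    rw [← preimage_image_eq (closure (M : Set E)) (toWeakSpace 𝕜 E).injective, this, preimage_univ]
  have hc : ((toWeakSpace 𝕜 E) ⁻¹' D).Countable := hDc.preimage (toWeakSpace 𝕜 E).injective
  have := (hc.isSeparable.span (R := 𝕜)).closure
  rw [hM] at this
  exact TopologicalSpace.isSeparable_univ_iff.1 this

open scoped ComplexOrder in
/-- Local convexity over `ℝ` is local convexity over `𝕜`, as convexity over `𝕜` involves only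
nonnegative, hence real, coefficients. -/
theorem LocallyConvexSpace.polynormableSpace (𝕜 : Type*) {E : Type*} [RCLike 𝕜] [AddCommGroup E]
    [Module 𝕜 E] [Module ℝ E] [IsScalarTower ℝ 𝕜 E] [TopologicalSpace E] [IsTopologicalAddGroup E]
    [ContinuousSMul 𝕜 E] [LocallyConvexSpace ℝ E] : PolynormableSpace 𝕜 E := by
  have : ContinuousSMul ℝ E := IsScalarTower.continuousSMul 𝕜
  have : LocallyConvexSpace 𝕜 E := ⟨fun x => (LocallyConvexSpace.convex_basis (𝕜 := ℝ) x).congr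
    (fun s => and_congr_right fun _ => ⟨fun h => convex_of_nonneg_surjective_algebraMap _
        (fun _ => RCLike.nonneg_iff_exists_ofReal.mp) h, fun h => h.lift ℝ⟩) fun _ _ => rfl⟩
  exact LocallyConvexSpace.toPolynormableSpace

/-- For a reflexive Fréchet space: weakly an `ℵ`-space iff separable iff weakly an `ℵ₀`-space. -/
theorem mainTheorem3 (𝕜 E : Type*) [RCLike 𝕜] [AddCommGroup E] [Module 𝕜 E] [Module ℝ E]
    [IsScalarTower ℝ 𝕜 E] [UniformSpace E] [IsUniformAddGroup E] [ContinuousSMul 𝕜 E]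
    [LocallyConvexSpace ℝ E] [TopologicalSpace.MetrizableSpace E] [CompleteSpace E]
    (hE : IsReflexiveLCS 𝕜 E) :
    (IsWeaklyAlephSpace 𝕜 E ↔ TopologicalSpace.SeparableSpace E) ∧
      (TopologicalSpace.SeparableSpace E ↔ IsWeaklyAlephZeroSpace 𝕜 E) := by
  have : PolynormableSpace 𝕜 E := LocallyConvexSpace.polynormableSpace 𝕜
  obtain ⟨p, hp⟩ := exists_isFundamentalSeq (𝕜 := 𝕜) (E := E)
  have h23 : TopologicalSpace.SeparableSpace E → IsWeaklyAlephZeroSpace 𝕜 E := fun _ => by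
    have := IsUniformAddGroup.uniformity_countably_generated (α := E)
    have : SecondCountableTopology E := UniformSpace.secondCountable_of_separable E
    exact hE.isWeaklyAlephZeroSpace_of_secondCountable hp
  exact ⟨⟨fun h => (hE.isWeaklyAlephZeroSpace hp h).separableSpace, fun h => (h23 h).isAlephSpace⟩,
    h23, fun h => h.separableSpace⟩
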